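/- All graphs are finite, simple, undirected and connected. For a graph $G$, a real number $c$ and a natural number $\mu$, say that $G$ *admits a system of $\mu$ collective additive tree $c$-spanners* if there is a set $\mathcal{T}$ of at most $\mu$ spanning trees of $G$ such that for any two vertices $u,v$ of $G$ there is a tree $T\in\mathcal{T}$ with $\mathrm{dist}_T(u,v)\le \mathrm{dist}_G(u,v)+c$. A graph is *weakly chordal* if neither it nor its complement contains an induced cycle with at least five vertices. A graph is *outerplanar* if it can be drawn in the plane without crossings so that every vertex lies on the boundary of the unbounded face. **Theorem.** Let $c>2$ be a real number. Then 1. there is no constant $\mu\in\mathbb{N}$ such that every weakly chordal graph admits a system of $\mu$ collective additive tree $c$-spanners; and 2. there is no constant $\mu\in\mathbb{N}$ such that every outerplanar graph admits a system of $\mu$ collective additive tree $c$-spanners. -/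

import Mathlib

namespace SimpleGraph

/-- `T` is a spanning tree of `G`: a subgraph on the same vertex set that is a tree. -/
def IsSpanningTreeOf {V : Type*} (T G : SimpleGraph V) : Prop :=
  T ≤ G ∧ T.IsTree

/-- `G` admits a system of `μ` collective additive tree `c`-spanners: there are at most `μ`
spanning trees of `G` such that every pair of vertices `u`, `v` has a tree `T` among them with
`dist_T(u, v) ≤ dist_G(u, v) + c`. -/
def AdmitsCollectiveTreeSpanners {V : Type*} (G : SimpleGraph V) (μ : ℕ) (c : ℝ) : Prop :=
  ∃ 𝒯 : Finset (SimpleGraph V), 𝒯.card ≤ μ ∧ (∀ T ∈ 𝒯, T.IsSpanningTreeOf G) ∧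
    ∀ u v : V, ∃ T ∈ 𝒯, (T.dist u v : ℝ) ≤ (G.dist u v : ℝ) + c

/-- `G` is weakly chordal: neither `G` nor its complement contains an induced cycle with at least
five vertices. -/
def IsWeaklyChordal {V : Type*} (G : SimpleGraph V) : Prop :=
  ∀ n : ℕ, 5 ≤ n → ¬ (cycleGraph n).IsIndContained G ∧ ¬ (cycleGraph n).IsIndContained Gᶜ

/-- A drawing of `G` in the Euclidean plane without crossings. Distinct vertices are distinct
points, every edge `uv` is a simple curve joining the points of `u` and `v`, a curve meets no
vertex other than its two ends, and two different curves meet only in points of vertices (hence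
only in common ends). The values of `arc` at non-edges play no role. -/
structure PlaneDrawing {V : Type*} (G : SimpleGraph V) where
  point : V → EuclideanSpace ℝ (Fin 2)
  arc : Sym2 V → Set (EuclideanSpace ℝ (Fin 2))
  point_injective : Function.Injective point
  arc_eq : ∀ u v : V, G.Adj u v →
    ∃ γ : _root_.Path (point u) (point v), Function.Injective γ ∧ Set.range γ = arc s(u, v)
  mem_of_point_mem_arc : ∀ e ∈ G.edgeSet, ∀ w : V, point w ∈ arc e → w ∈ e
  arc_inter_arc : ∀ e ∈ G.edgeSet, ∀ f ∈ G.edgeSet, e ≠ f → arc e ∩ arc f ⊆ Set.range point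

/-- The set of all points of the plane that are covered by the drawing. -/
def PlaneDrawing.support {V : Type*} {G : SimpleGraph V} (D : G.PlaneDrawing) :
    Set (EuclideanSpace ℝ (Fin 2)) :=
  Set.range D.point ∪ ⋃ e ∈ G.edgeSet, D.arc e

/-- The unbounded face of a drawing: the points off the drawing whose connected component in the
complement of the drawing is unbounded. -/
def PlaneDrawing.unboundedFace {V : Type*} {G : SimpleGraph V} (D : G.PlaneDrawing) :
    Set (EuclideanSpace ℝ (Fin 2)) :=
  {p | p ∈ D.supportᶜ ∧ ¬ Bornology.IsBounded (connectedComponentIn D.supportᶜ p)}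

/-- `G` is outerplanar: it has a plane drawing without crossings in which every vertex belongs to
the unbounded face, that is, lies on the boundary of that face. -/
def IsOuterplanar {V : Type*} (G : SimpleGraph V) : Prop :=
  ∃ D : G.PlaneDrawing, ∀ v : V, D.point v ∈ frontier D.unboundedFace

end SimpleGraph

/-! One family of graphs, the binary trees of ladders, refutes both claims. Two rails of `M + 1`
edges climb from each node to its two children, and rungs join the rails level by level, so sibling
nodes are adjacent. In a spanning tree, call the excess of a climb from a node to a descendant its
tree distance minus the height difference. Since a node separates everything above it from the rest,
excess is additive along climbs.

If a tree has no excess from `w` to either child, its two paths meet only in `w`, so the siblings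
are `2 * (M + 1)` apart in it. If instead it has excess above `C` between one child and some
descendant of that child, then the distance from this descendant to the other child is stretched by
more than `C`. The combinatorial core, `exists_common_bad_pair`, finds one node and one descendant
for which each of the `μ` trees fails in one of these two ways; `not_admits_ladderTree` turns this
into a bad pair of vertices.

Weak chordality follows by looking at a highest vertex of a cycle: at most two of its neighbors are
not higher, one below it and one across a rung. Outerplanarity follows by placing the vertices on a
line without crossing edges and lifting the line to a parabola. -/

namespace LadderTree

open SimpleGraph

/-! ### Additive excess functions on a binary tree -/

/-- Depth that suffices to find a pair of nodes that is bad for all trees when at most `k` trees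
are not exact. -/
def depthBound (P : ℕ) : ℕ → ℕ
  | 0 => 1
  | k + 1 => 1 + (P + 1) * depthBound P k

/-- The sum of the deficits `C + 1 - E` is a potential. As long as some tree has excess at most `C`
and is not exact within the next `ℓ` levels, climbing to a witness of this lowers the potential;
hence at most `P` climbs of length at most `ℓ` occur. -/
lemma exists_excess_or_exact {α : Type*} (𝒯 : Finset α) (E : α → List Bool → List Bool → ℕ)
    (d C ℓ : ℕ)
    (hadd : ∀ t ∈ 𝒯, ∀ w v u : List Bool, (u ++ (v ++ w)).length ≤ d →
      E t w (u ++ (v ++ w)) = E t w (v ++ w) + E t (v ++ w) (u ++ (v ++ w)))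
    (P : ℕ) (w v : List Bool) (hd : w.length + v.length + P * ℓ + ℓ ≤ d)
    (hP : ∑ t ∈ 𝒯, (C + 1 - E t w (v ++ w)) ≤ P) :
    ∃ v' : List Bool, v'.length ≤ v.length + P * ℓ ∧ ∀ t ∈ 𝒯, C < E t w (v' ++ w) ∨
      ∀ u : List Bool, u.length ≤ ℓ → E t (v' ++ w) (u ++ (v' ++ w)) = 0 := by
  induction P generalizing v with
  | zero =>
    refine ⟨v, by simp, fun t ht => Or.inl ?_⟩
    have := Finset.sum_eq_zero_iff.mp (Nat.le_zero.mp hP) t ht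
    omega
  | succ P ih =>
    by_cases h : ∀ t ∈ 𝒯, C < E t w (v ++ w) ∨
      ∀ u : List Bool, u.length ≤ ℓ → E t (v ++ w) (u ++ (v ++ w)) = 0
    · exact ⟨v, by omega, h⟩
    push Not at h
    obtain ⟨t, ht, hC, u, hu, hne⟩ := h
    have hmul : (P + 1) * ℓ = P * ℓ + ℓ := by ring
    have hlen : (u ++ v).length = u.length + v.length := List.length_append
    have hle : ∀ s ∈ 𝒯, E s w (u ++ v ++ w) = E s w (v ++ w) + E s (v ++ w) (u ++ (v ++ w)) := by
      intro s hs
      rw [List.append_assoc]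
      refine hadd s hs w v u ?_
      simp only [List.length_append]
      omega
    obtain ⟨v', hv', h'⟩ := ih (u ++ v) (by omega) (by
      -- Additivity keeps every summand from growing, and that of `t` was positive and drops
      -- strictly.
      have : ∑ t ∈ 𝒯, (C + 1 - E t w (u ++ v ++ w)) < ∑ t ∈ 𝒯, (C + 1 - E t w (v ++ w)) := by
        refine Finset.sum_lt_sum (fun s hs => ?_) ⟨t, ht, ?_⟩
        · have := hle s hs
          omega
        · have := hle t ht
          omega
      omega)
    exact ⟨v', by omega, h'⟩

/-- `N` contains the trees not known to be exact above `w`. Climb from the child `false :: w`: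
either all trees of `N` accumulate excess above `C`, while the others are exact at `w` and satisfy
`B`, or some tree of `N` becomes exact higher up and leaves `N`. The second case occurs at most `k`
times. -/
lemma exists_common_bad_pair {α : Type*} (𝒯 : Finset α) (E : α → List Bool → List Bool → ℕ)
    (B : α → List Bool → Prop) (d C : ℕ)
    (hadd : ∀ t ∈ 𝒯, ∀ w v u : List Bool, (u ++ (v ++ w)).length ≤ d →
      E t w (u ++ (v ++ w)) = E t w (v ++ w) + E t (v ++ w) (u ++ (v ++ w)))
    (hB : ∀ t ∈ 𝒯, ∀ w : List Bool, w.length + 1 ≤ d → E t w (false :: w) = 0 →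
      E t w (true :: w) = 0 → B t w)
    (P : ℕ) (hP : 𝒯.card * (C + 1) ≤ P) (k : ℕ) (w : List Bool)
    (hd : w.length + depthBound P k ≤ d) (N : Finset α) (hN : N.card ≤ k)
    (hex : ∀ t ∈ 𝒯, t ∉ N → ∀ u : List Bool, u.length ≤ depthBound P k → E t w (u ++ w) = 0) :
    ∃ w v : List Bool, v.length + w.length + 1 ≤ d ∧
      ∀ t ∈ 𝒯, C < E t (false :: w) (v ++ false :: w) ∨ B t w := by
  classical
  induction k generalizing w N with
  | zero =>
    have hN0 : N = ∅ := Finset.card_eq_zero.mp (Nat.le_zero.mp hN)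
    simp only [depthBound] at hd hex
    refine ⟨w, [], by simpa using hd, fun t ht => Or.inr (hB t ht w hd ?_ ?_)⟩
    · exact hex t ht (by simp [hN0]) [false] (by simp)
    · exact hex t ht (by simp [hN0]) [true] (by simp)
  | succ k ih =>
    set ℓ := depthBound P k with hℓ
    have hL : depthBound P (k + 1) = 1 + (P * ℓ + ℓ) := by
      simp only [depthBound, ← hℓ]; ring
    rw [hL] at hd hex
    obtain ⟨v, hv, h⟩ := exists_excess_or_exact 𝒯 E d C ℓ hadd P (false :: w) []
      (by simp only [List.length_cons, List.length_nil]; omega) (by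
        refine le_trans (Finset.sum_le_sum (g := fun _ => C + 1) fun t _ => Nat.sub_le _ _) ?_
        simpa using hP)
    simp only [List.length_nil, zero_add] at hv
    -- Excess is a natural number and additive, so exactness on a long climb passes to its upper
    -- part.
    have hex' : ∀ t ∈ 𝒯, t ∉ N → ∀ u : List Bool, u.length ≤ ℓ →
        E t (v ++ false :: w) (u ++ (v ++ false :: w)) = 0 := by
      intro t ht htN u hu
      have h1 := hex t ht htN (u ++ (v ++ [false])) (by
        simp only [List.length_append, List.length_cons, List.length_nil]; omega)
      have h2 := hadd t ht w (v ++ [false]) u (by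
        simp only [List.length_append, List.length_cons, List.length_nil]; omega)
      simp only [List.append_assoc, List.cons_append, List.nil_append] at h1 h2
      omega
    by_cases hall : ∀ t ∈ 𝒯, t ∈ N → C < E t (false :: w) (v ++ false :: w)
    · refine ⟨w, v, by omega, fun t ht => ?_⟩
      by_cases htN : t ∈ N
      · exact Or.inl (hall t ht htN)
      · refine Or.inr (hB t ht w (by omega) ?_ ?_)
        · exact hex t ht htN [false] (by simp)
        · exact hex t ht htN [true] (by simp)
    · push Not at hall
      obtain ⟨s, hs, hsN, hsC⟩ := hall
      -- The depth `1 + (P * ℓ + ℓ)` pays for the step to the child, for the climb along `v`, and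
      -- for the `ℓ` levels of exactness still needed.
      refine ih (v ++ false :: w) (by
        simp only [List.length_append, List.length_cons]; omega) (N.erase s) ?_ ?_
      · rw [Finset.card_erase_of_mem hsN]; omega
      · intro t ht htN
        by_cases hts : t = s
        · subst hts
          exact (h t ht).resolve_left (by omega)
        · exact hex' t ht fun h => htN (Finset.mem_erase.mpr ⟨hts, h⟩)

/-! ### The binary tree of ladders and its heights -/

/-- `IsStep M a b`: the vertex `b` lies one step above `a`. The vertex `(w, k)` is the `k`-th vertex
of the rail that leads to the node `w`, and its last vertex `(w, M)` is the node `w` itself. -/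
def IsStep (M : ℕ) (a b : List Bool × ℕ) : Prop :=
  (b.1 = a.1 ∧ b.2 = a.2 + 1) ∨ ∃ c, b.1 = c :: a.1 ∧ a.2 = M ∧ b.2 = 0

/-- The two ends of a rung between the two rails that start in the same node. -/
def IsRung (a b : List Bool × ℕ) : Prop :=
  ∃ c w, a.1 = c :: w ∧ b.1 = (!c) :: w ∧ a.2 = b.2

/-- Vertices of the binary tree of ladders of depth `d`. -/
abbrev Vertex (M d : ℕ) : Type := {z : List Bool × ℕ // z.1.length ≤ d ∧ z.2 ≤ M}

/-- The distance from the bottom vertex. -/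
def height {M d : ℕ} (z : Vertex M d) : ℕ := z.1.1.length * (M + 1) + z.1.2

/-- The binary tree of ladders: two rails leave every node of a binary tree, and they are joined by
rungs. -/
def ladderTree (M d : ℕ) : SimpleGraph (Vertex M d) where
  Adj a b := IsStep M a.1 b.1 ∨ IsStep M b.1 a.1 ∨ IsRung a.1 b.1
  symm := ⟨by
    rintro a b (h | h | ⟨c, w, h1, h2, h3⟩)
    · exact Or.inr (Or.inl h)
    · exact Or.inl h
    · exact Or.inr (Or.inr ⟨!c, w, h2, by simpa using h1, h3.symm⟩)⟩
  loopless := ⟨by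
    rintro a (h | h | ⟨c, w, h1, h2, h3⟩)
    · rcases h with ⟨_, h⟩ | ⟨c, h, _⟩
      · omega
      · simpa using congrArg List.length h
    · rcases h with ⟨_, h⟩ | ⟨c, h, _⟩
      · omega
      · simpa using congrArg List.length h
    · rw [h1] at h2
      simp at h2⟩

variable {M d : ℕ}

instance finite_vertex : Finite (Vertex M d) := by
  have h : Set.Finite {z : List Bool × ℕ | z.1.length ≤ d ∧ z.2 ≤ M} :=
    ((List.finite_length_le Bool d).prod (Set.finite_Iic M)).subset fun z hz => ⟨hz.1, hz.2⟩
  exact h.to_subtype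

lemma IsStep.height_eq {a b : Vertex M d} (h : IsStep M a.1 b.1) : height b = height a + 1 := by
  rcases h with ⟨h1, h2⟩ | ⟨c, h1, h2, h3⟩
  · simp only [height, h1, h2]; ring
  · simp only [height, h1, h2, h3, List.length_cons]; ring

lemma IsRung.height_eq {a b : Vertex M d} (h : IsRung a.1 b.1) : height b = height a := by
  obtain ⟨c, w, h1, h2, h3⟩ := h
  simp [height, h1, h2, h3]

lemma height_le_of_adj {a b : Vertex M d} (h : (ladderTree M d).Adj a b) :
    height b ≤ height a + 1 := by
  rcases h with h | h | h
  · exact h.height_eq.le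
  · have := h.height_eq; omega
  · have := h.height_eq; omega

lemma height_le_add_length {T : SimpleGraph (Vertex M d)} (hT : T ≤ ladderTree M d)
    {a b : Vertex M d} (p : T.Walk a b) : height b ≤ height a + p.length := by
  induction p with
  | nil => simp
  | cons h p ih =>
    have := height_le_of_adj (hT h)
    simp only [Walk.length_cons]
    omega

lemma height_le_add_dist {T : SimpleGraph (Vertex M d)} (hT : T ≤ ladderTree M d)
    (hc : T.Connected) (a b : Vertex M d) : height b ≤ height a + T.dist a b := by
  obtain ⟨p, hp⟩ := hc.exists_walk_length_eq_dist a b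
  rw [← hp]
  exact height_le_add_length hT p

/-- Walks that climb in every step only pass through ancestors of their end. -/
lemma isSuffix_of_length_le {T : SimpleGraph (Vertex M d)} (hT : T ≤ ladderTree M d)
    {a b : Vertex M d} (p : T.Walk a b) (hp : height a + p.length ≤ height b) :
    a.1.1 <:+ b.1.1 := by
  induction p with
  | nil => exact List.suffix_rfl
  | @cons a a' b h p ih =>
    simp only [Walk.length_cons] at hp
    have h1 := height_le_add_length hT p
    have h2 := ih (by have := height_le_of_adj (hT h); omega)
    refine List.IsSuffix.trans ?_ h2
    rcases hT h with h | h | h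
    · rcases h with ⟨h, _⟩ | ⟨c, h, _⟩
      · rw [h]
      · rw [h]; exact List.suffix_cons _ _
    · have := h.height_eq; omega
    · have := h.height_eq; omega

/-- The node `w`; the value for a list `w` that is too long plays no role. -/
def node (M d : ℕ) (w : List Bool) : Vertex M d :=
  if h : w.length ≤ d then ⟨(w, M), h, le_rfl⟩ else ⟨([], M), Nat.zero_le _, le_rfl⟩

lemma node_val {w : List Bool} (h : w.length ≤ d) : (node M d w).1 = (w, M) := by
  simp [node, h]

lemma height_node {w : List Bool} (h : w.length ≤ d) :
    height (node M d w) = w.length * (M + 1) + M := by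
  simp [height, node_val h]

lemma reachable_bottom (z : Vertex M d) :
    (ladderTree M d).Reachable z ⟨([], 0), Nat.zero_le _, Nat.zero_le _⟩ := by
  obtain ⟨⟨w, k⟩, hw, hk⟩ := z
  induction w generalizing k with
  | nil =>
    induction k with
    | zero => exact Reachable.refl _
    | succ k ih =>
      have hk' : k ≤ M := by simp only at hk; omega
      have h : (ladderTree M d).Adj ⟨([], k + 1), hw, hk⟩ ⟨([], k), hw, hk'⟩ :=
        Or.inr (Or.inl (Or.inl ⟨rfl, rfl⟩))
      exact h.reachable.trans (ih hw hk')
  | cons c w ihw =>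
    simp only [List.length_cons] at hw
    induction k with
    | zero =>
      exact Reachable.trans (Adj.reachable (Or.inr (Or.inl (Or.inr ⟨c, rfl, rfl, rfl⟩))))
        (ihw M (by simp only; omega) le_rfl)
    | succ k ih =>
      have hk' : k ≤ M := by simp only at hk; omega
      have h : (ladderTree M d).Adj ⟨(c :: w, k + 1), hw, hk⟩ ⟨(c :: w, k), hw, hk'⟩ :=
        Or.inr (Or.inl (Or.inl ⟨rfl, rfl⟩))
      exact h.reachable.trans (ih hk')

lemma ladderTree_connected : (ladderTree M d).Connected where
  preconnected a b := (reachable_bottom a).trans (reachable_bottom b).symm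
  nonempty := ⟨⟨([], 0), Nat.zero_le _, Nat.zero_le _⟩⟩

lemma dist_rail_le (w : List Bool) (c : Bool) (hw : (c :: w).length ≤ d) (k : ℕ) (hk : k ≤ M) :
    (ladderTree M d).dist (node M d w) ⟨(c :: w, k), hw, hk⟩ ≤ k + 1 := by
  have hw' : w.length ≤ d := by simp only [List.length_cons] at hw; omega
  induction k with
  | zero =>
    refine (dist_eq_one_iff_adj.mpr (Or.inl (Or.inr ⟨c, ?_⟩))).le
    simp [node_val hw']
  | succ k ih =>
    have h1 := ih (by omega)
    have h2 : (ladderTree M d).Adj ⟨(c :: w, k), hw, by simp only; omega⟩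
        ⟨(c :: w, k + 1), hw, hk⟩ := Or.inl (Or.inl ⟨rfl, rfl⟩)
    have h3 := ladderTree_connected.dist_triangle (u := node M d w)
      (v := ⟨(c :: w, k), hw, by simp only; omega⟩) (w := ⟨(c :: w, k + 1), hw, hk⟩)
    rw [dist_eq_one_iff_adj.mpr h2] at h3
    omega

lemma dist_node_le (w v : List Bool) (h : (v ++ w).length ≤ d) :
    (ladderTree M d).dist (node M d w) (node M d (v ++ w)) ≤ v.length * (M + 1) := by
  induction v with
  | nil => simp
  | cons c v ih =>
    simp only [List.cons_append] at h ⊢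
    have h' : (v ++ w).length ≤ d := by simp only [List.length_cons] at h; omega
    have h1 := ih h'
    have h2 := dist_rail_le (M := M) (v ++ w) c h M le_rfl
    have h3 : (⟨(c :: (v ++ w), M), h, le_rfl⟩ : Vertex M d) = node M d (c :: (v ++ w)) :=
      Subtype.ext (node_val h).symm
    rw [h3] at h2
    have h4 := ladderTree_connected.dist_triangle (u := node M d w)
      (v := node M d (v ++ w)) (w := node M d (c :: (v ++ w)))
    rw [List.length_cons, add_mul, one_mul]
    omega

/-! ### Distances in spanning trees of the ladder tree -/

/-- A shortest walk has to leave `S`, and the first vertex that it meets outside `S` is `x`. -/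
lemma dist_eq_add_of_separator {V : Type*} {T : SimpleGraph V} (hT : T.Connected) {S : Set V}
    {x u v : V} (hS : ∀ a b, T.Adj a b → a ∈ S → b ∉ S → b = x) (hu : u ∈ S) (hv : v ∉ S) :
    T.dist u v = T.dist u x + T.dist x v := by
  classical
  obtain ⟨p, hp⟩ := hT.exists_walk_length_eq_dist u v
  have hx : x ∈ p.support := by
    clear hp
    induction p with
    | nil => exact absurd hu hv
    | @cons a b c h p ih =>
      by_cases hb : b ∈ S
      · exact List.mem_cons_of_mem _ (ih hb hv)
      · rw [Walk.support_cons, ← hS a b h hu hb]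
        exact List.mem_cons_of_mem _ p.start_mem_support
  refine le_antisymm hT.dist_triangle ?_
  have h := congrArg Walk.length (p.take_spec hx)
  rw [Walk.length_append] at h
  have h1 := dist_le (p.takeUntil x hx)
  have h2 := dist_le (p.dropUntil x hx)
  omega

/-- Only the node `w` separates the vertices above it from the others. -/
lemma eq_node_of_adj {w : List Bool} (hw : w.length ≤ d) {a b : Vertex M d}
    (h : (ladderTree M d).Adj a b) (ha : w <:+ a.1.1 ∧ a.1.1 ≠ w)
    (hb : ¬ (w <:+ b.1.1 ∧ b.1.1 ≠ w)) : b = node M d w := by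
  rcases h with (⟨h, _⟩ | ⟨c, h, _⟩) | (⟨h, _⟩ | ⟨c, h, h2, _⟩) | ⟨c, u, h1, h2, _⟩
  · exact absurd (h ▸ ha) hb
  · refine absurd ⟨ha.1.trans (h ▸ List.suffix_cons _ _), fun h' => ?_⟩ hb
    have h1 := congrArg List.length h'
    have h2 := ha.1.length_le
    rw [h, List.length_cons] at h1
    omega
  · exact absurd (h ▸ ha) hb
  · rw [h] at ha
    have h3 := (List.suffix_cons_iff.mp ha.1).resolve_left (Ne.symm ha.2)
    have h4 : b.1.1 = w := by
      by_contra h5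
      exact hb ⟨h3, h5⟩
    exact Subtype.ext ((Prod.ext h4 h2).trans (node_val hw).symm)
  · rw [h1] at ha
    have h3 := (List.suffix_cons_iff.mp ha.1).resolve_left (Ne.symm ha.2)
    rw [h2] at hb
    refine absurd ⟨h3.trans (List.suffix_cons _ _), fun h' => ?_⟩ hb
    have h4 := congrArg List.length h'
    have h5 := h3.length_le
    rw [List.length_cons] at h4
    omega

lemma dist_node_add {T : SimpleGraph (Vertex M d)} (hT : T ≤ ladderTree M d) (hc : T.Connected)
    (w v : List Bool) (h : (v ++ w).length ≤ d) {z : Vertex M d}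
    (hz : ¬ (w <:+ z.1.1 ∧ z.1.1 ≠ w)) :
    T.dist (node M d (v ++ w)) z = T.dist (node M d (v ++ w)) (node M d w) +
      T.dist (node M d w) z := by
  rcases eq_or_ne v [] with rfl | hv
  · simp
  · have hw : w.length ≤ d := by rw [List.length_append] at h; omega
    refine dist_eq_add_of_separator hc (S := {a | w <:+ a.1.1 ∧ a.1.1 ≠ w})
      (fun a b hab ha hb => eq_node_of_adj hw (hT hab) ha hb) ?_ hz
    simp [node_val h, hv]

/-- A tree that keeps the distances between a node and the two nodes above it does not use the
rungs between them. -/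
lemma dist_node_of_exact {T : SimpleGraph (Vertex M d)} (hT : T ≤ ladderTree M d) (ht : T.IsTree)
    (w : List Bool) (hw : w.length + 1 ≤ d)
    (h0 : T.dist (node M d w) (node M d (false :: w)) = M + 1)
    (h1 : T.dist (node M d w) (node M d (true :: w)) = M + 1) :
    T.dist (node M d (false :: w)) (node M d (true :: w)) = 2 * (M + 1) := by
  classical
  obtain ⟨p, hp, hpl⟩ := ht.1.exists_path_of_dist (node M d w) (node M d (false :: w))
  obtain ⟨q, hq, hql⟩ := ht.1.exists_path_of_dist (node M d w) (node M d (true :: w))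
  -- A walk as short as the height difference climbs in every step, so it stays among the ancestors
  -- of its end.
  have key : ∀ (c : Bool) (r : T.Walk (node M d w) (node M d (c :: w))), r.length = M + 1 →
      ∀ z ∈ r.support, z.1.1 <:+ c :: w := by
    intro c r hr z hz
    have h := congrArg Walk.length (r.take_spec hz)
    rw [Walk.length_append] at h
    have h2 := height_le_add_length hT (r.takeUntil z hz)
    have h3 : height (node M d (c :: w)) = height (node M d w) + (M + 1) := by
      rw [height_node (w := w) (by omega), height_node (w := c :: w) (by rw [List.length_cons]; omega),
        List.length_cons]
      ring
    have h4 := isSuffix_of_length_le hT (r.dropUntil z hz) (by omega)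
    rwa [node_val (by rw [List.length_cons]; omega)] at h4
  -- A common vertex of the two paths is an ancestor of both children, hence not higher than the
  -- node `w`; only the start of a climbing path qualifies. So the two paths concatenate to the tree
  -- path between the children.
  have hpath : (p.reverse.append q).IsPath := by
    rw [Walk.isPath_def, Walk.support_append, List.nodup_append']
    refine ⟨by simpa [Walk.support_reverse] using hp.support_nodup,
      hq.support_nodup.sublist (List.tail_sublist _), fun z hz hz' => ?_⟩
    rw [Walk.support_reverse, List.mem_reverse] at hz
    have hzq : z ∈ q.support := List.mem_of_mem_tail hz'
    have e1 := key false p (by omega) z hz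
    have e2 := key true q (by omega) z hzq
    have e3 : z.1.1 <:+ w := by
      rcases List.suffix_cons_iff.mp e1 with e | e
      · rw [e] at e2
        rcases List.suffix_cons_iff.mp e2 with e' | e'
        · simp at e'
        · have := e'.length_le
          simp at this
      · exact e
    have hle : height z ≤ height (node M d w) := by
      rw [height_node (by omega)]
      exact add_le_add (Nat.mul_le_mul_right _ e3.length_le) z.2.2
    have h := congrArg Walk.length (p.take_spec hz)
    rw [Walk.length_append] at h
    have h2 := height_le_add_length hT (p.dropUntil z hz)
    have h3 : height (node M d (false :: w)) = height (node M d w) + (M + 1) := by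
      rw [height_node (w := w) (by omega), height_node (w := false :: w) (by rw [List.length_cons]; omega),
        List.length_cons]
      ring
    have hzw : node M d w = z := Walk.eq_of_length_eq_zero (p := p.takeUntil z hz) (by omega)
    have hn := hq.support_nodup
    rw [← Walk.cons_tail_support, List.nodup_cons] at hn
    exact hn.1 (hzw ▸ hz')
  obtain ⟨r, hr, hrl⟩ := ht.1.exists_path_of_dist (node M d (false :: w)) (node M d (true :: w))
  have := (ht.existsUnique_path _ _).unique hpath hr
  rw [← hrl, ← this, Walk.length_append, Walk.length_reverse]
  omega

lemma not_admits_ladderTree (μ C : ℕ) (c : ℝ) (hc : c ≤ C) (hM : C ≤ M)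
    (hd : depthBound (μ * (C + 1)) μ ≤ d) :
    ¬ (ladderTree M d).AdmitsCollectiveTreeSpanners μ c := by
  rintro ⟨𝒯, hcard, htree, hgood⟩
  -- The subtraction does not truncate on the pairs that matter: this is `hlow`.
  let E : SimpleGraph (Vertex M d) → List Bool → List Bool → ℕ := fun T w v =>
    T.dist (node M d v) (node M d w) + w.length * (M + 1) - v.length * (M + 1)
  have hlow : ∀ T ∈ 𝒯, ∀ w v : List Bool, (v ++ w).length ≤ d →
      (v ++ w).length * (M + 1) ≤ T.dist (node M d (v ++ w)) (node M d w) +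
        w.length * (M + 1) := by
    intro T hT w v h
    have := height_le_add_dist (htree T hT).1 (htree T hT).2.1 (node M d w) (node M d (v ++ w))
    rw [height_node h, height_node (by rw [List.length_append] at h; omega),
      SimpleGraph.dist_comm] at this
    omega
  obtain ⟨w, v, hlen, hbad⟩ := exists_common_bad_pair 𝒯 E
    (fun T w => T.dist (node M d (false :: w)) (node M d (true :: w)) = 2 * (M + 1)) d C
    (by
      intro T hT w v u h
      have h1 := dist_node_add (htree T hT).1 (htree T hT).2.1 (v ++ w) u h
        (z := node M d w) (by
          simp only [List.length_append] at h
          rw [node_val (by omega)]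
          rintro ⟨h2, h3⟩
          exact h3 (h2.eq_of_length_le (by simp)).symm)
      have h2 := hlow T hT (v ++ w) u h
      have h3 := hlow T hT w v (by simp only [List.length_append] at h ⊢; omega)
      simp only [E]
      omega)
    (by
      intro T hT w hw h0 h1
      have h2 := hlow T hT w [false] (by simpa using hw)
      have h3 := hlow T hT w [true] (by simpa using hw)
      simp only [E] at h0 h1
      simp only [List.cons_append, List.nil_append, List.length_cons, add_mul, one_mul] at *
      refine dist_node_of_exact (htree T hT).1 (htree T hT).2 w hw ?_ ?_
      · rw [SimpleGraph.dist_comm]; omega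
      · rw [SimpleGraph.dist_comm]; omega)
    (μ * (C + 1)) (Nat.mul_le_mul_right _ hcard) μ [] (by simpa using hd) 𝒯 hcard
    (fun t ht hn => absurd ht hn)
  have hx : (false :: w).length ≤ d := by simp only [List.length_cons]; omega
  have hy : (true :: w).length ≤ d := by simp only [List.length_cons]; omega
  have hvx : (v ++ false :: w).length ≤ d := by
    simp only [List.length_append, List.length_cons]; omega
  obtain ⟨T, hT, hle⟩ := hgood (node M d (v ++ false :: w)) (node M d (true :: w))
  have hadd := dist_node_add (htree T hT).1 (htree T hT).2.1 (false :: w) v hvx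
    (z := node M d (true :: w)) (by
      rw [node_val hy]
      rintro ⟨h2, -⟩
      simpa using h2.eq_of_length_le (by simp))
  have hG : (ladderTree M d).dist (node M d (v ++ false :: w)) (node M d (true :: w)) ≤
      v.length * (M + 1) + 1 := by
    have h1 := dist_node_le (M := M) (false :: w) v hvx
    have h2 : (ladderTree M d).Adj (node M d (false :: w)) (node M d (true :: w)) :=
      Or.inr (Or.inr ⟨false, w, by simp [node_val hx], by simp [node_val hy],
        by simp [node_val hx, node_val hy]⟩)
    have h3 := ladderTree_connected.dist_triangle (u := node M d (v ++ false :: w))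
      (v := node M d (false :: w)) (w := node M d (true :: w))
    rw [SimpleGraph.dist_comm] at h1
    rw [dist_eq_one_iff_adj.mpr h2] at h3
    omega
  have h1 := hlow T hT (false :: w) v hvx
  have hne : node M d (false :: w) ≠ node M d (true :: w) := by
    intro h
    have := congrArg (fun z => z.1.1) h
    simp [node_val hx, node_val hy] at this
  have hpos := (htree T hT).2.1.pos_dist_of_ne hne
  -- The tree path passes through `false :: w`. Excess above `C` on its first part suffices, as the
  -- second part has length at least 1; otherwise the second part has length `2 * (M + 1)`, which
  -- exceeds `1 + C` because `C ≤ M`.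
  have hbig : (ladderTree M d).dist (node M d (v ++ false :: w)) (node M d (true :: w)) + C <
      T.dist (node M d (v ++ false :: w)) (node M d (true :: w)) := by
    rw [hadd]
    simp only [List.length_append, add_mul] at h1
    rcases hbad T hT with h | h
    · simp only [E, List.length_append, add_mul] at h
      omega
    · omega
  have : ((ladderTree M d).dist (node M d (v ++ false :: w)) (node M d (true :: w)) : ℝ) + C <
      T.dist (node M d (v ++ false :: w)) (node M d (true :: w)) := by exact_mod_cast hbig
  linarith

/-! ### Weak chordality -/

lemma IsStep.unique {a a' b : Vertex M d} (h : IsStep M a.1 b.1) (h' : IsStep M a'.1 b.1) :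
    a = a' := by
  rcases h with ⟨h1, h2⟩ | ⟨c, h1, h2, h3⟩ <;> rcases h' with ⟨h1', h2'⟩ | ⟨c', h1', h2', h3'⟩
  · exact Subtype.ext (Prod.ext (h1.symm.trans h1') (by omega))
  · omega
  · omega
  · rw [h1, List.cons.injEq] at h1'
    exact Subtype.ext (Prod.ext h1'.2 (by omega))

lemma IsRung.unique {a a' b : Vertex M d} (h : IsRung b.1 a.1) (h' : IsRung b.1 a'.1) :
    a = a' := by
  obtain ⟨c, w, h1, h2, h3⟩ := h
  obtain ⟨c', w', h1', h2', h3'⟩ := h'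
  rw [h1, List.cons.injEq] at h1'
  refine Subtype.ext (Prod.ext ?_ (h3.symm.trans h3'))
  rw [h2, h2', h1'.1, h1'.2]

lemma isStep_or_isRung {a z : Vertex M d} (h : (ladderTree M d).Adj z a)
    (hle : height a ≤ height z) : IsStep M a.1 z.1 ∨ IsRung z.1 a.1 := by
  rcases h with h | h
  · have := h.height_eq
    omega
  · exact h

/-- Below a rung lies either the next rung, closing a 4-cycle, or the common node of the two rails,
closing a triangle. -/
lemma eq_or_adj_of_isRung {z u v t : Vertex M d} (hv : IsRung z.1 v.1) (hu : IsStep M u.1 z.1)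
    (ht : IsStep M t.1 v.1) : t = u ∨ (ladderTree M d).Adj t u := by
  obtain ⟨c, w, h1, h2, h3⟩ := hv
  rcases hu with ⟨hu1, hu2⟩ | ⟨b, hu1, hu2, hu3⟩ <;>
    rcases ht with ⟨ht1, ht2⟩ | ⟨b', ht1, ht2, ht3⟩
  · refine Or.inr (Or.inr (Or.inr ⟨!c, w, ?_, ?_, ?_⟩))
    · rw [← ht1, h2]
    · rw [← hu1, h1, Bool.not_not]
    · omega
  · omega
  · omega
  · rw [h2, List.cons.injEq] at ht1
    rw [h1, List.cons.injEq] at hu1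
    exact Or.inl (Subtype.ext (Prod.ext (ht1.2.symm.trans hu1.2) (ht2.trans hu2.symm)))

/-- A vertex of maximal height is not the middle of a path on five vertices of a long induced
cycle. -/
lemma not_middle_of_path {a b z c e : Vertex M d} (hab : (ladderTree M d).Adj b a)
    (hbz : (ladderTree M d).Adj z b) (hzc : (ladderTree M d).Adj z c)
    (hce : (ladderTree M d).Adj c e) (hbc : b ≠ c) (haz : a ≠ z) (hez : e ≠ z) (hac : a ≠ c)
    (hac' : ¬ (ladderTree M d).Adj a c) (heb : e ≠ b) (heb' : ¬ (ladderTree M d).Adj e b)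
    (ha : height a ≤ height z) (hb : height b ≤ height z) (hc : height c ≤ height z)
    (he : height e ≤ height z) : False := by
  have key : ∀ {u v t : Vertex M d}, IsStep M u.1 z.1 → IsRung z.1 v.1 →
      (ladderTree M d).Adj v t → t ≠ z → height t ≤ height z →
      t = u ∨ (ladderTree M d).Adj t u := by
    intro u v t hu hv hvt htz ht
    rcases isStep_or_isRung hvt (by rwa [hv.height_eq]) with h | h
    · exact eq_or_adj_of_isRung hv hu h
    · obtain ⟨c, w, h1, h2, h3⟩ := hv
      exact absurd (h.unique ⟨!c, w, h2, by simpa using h1, h3.symm⟩) htz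
  rcases isStep_or_isRung hbz hb with h | h <;> rcases isStep_or_isRung hzc hc with h' | h'
  · exact hbc (h.unique h')
  · exact (key h h' hce hez he).elim heb heb'
  · exact (key h' h hab haz ha).elim hac hac'
  · exact hbc (h.unique h')

/-- Pigeonhole: a neighbor that is not higher is the unique vertex below `z` or the unique one
across a rung. -/
lemma not_three_lower_neighbors {z a b c : Vertex M d} (ha : (ladderTree M d).Adj z a)
    (hb : (ladderTree M d).Adj z b) (hc : (ladderTree M d).Adj z c) (hab : a ≠ b) (hac : a ≠ c)
    (hbc : b ≠ c) (ha' : height a ≤ height z) (hb' : height b ≤ height z)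
    (hc' : height c ≤ height z) : False := by
  rcases isStep_or_isRung ha ha' with h1 | h1 <;> rcases isStep_or_isRung hb hb' with h2 | h2 <;>
    rcases isStep_or_isRung hc hc' with h3 | h3
  · exact hab (h1.unique h2)
  · exact hab (h1.unique h2)
  · exact hac (h1.unique h3)
  · exact hbc (h2.unique h3)
  · exact hbc (h2.unique h3)
  · exact hac (h1.unique h3)
  · exact hab (h1.unique h2)
  · exact hab (h1.unique h2)

lemma val_nsmul_one (k j : ℕ) : (j • (1 : Fin (k + 5))).val = j % (k + 5) := by
  induction j with
  | zero => simp
  | succ j ih =>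
    have h1 : (1 : Fin (k + 5)).val = 1 := by simp
    rw [succ_nsmul, Fin.val_add, ih, h1, Nat.mod_add_mod]

lemma ne_of_sub_eq_nsmul_one {k : ℕ} (j : ℕ) (h0 : 0 < j) (hj : j < k + 5) {x y : Fin (k + 5)}
    (h : y - x = j • (1 : Fin (k + 5))) : x ≠ y := by
  rintro rfl
  have := val_nsmul_one k j
  rw [← h, sub_self, Nat.mod_eq_of_lt hj] at this
  simp at this
  omega

lemma not_cycleGraph_isIndContained (n : ℕ) (hn : 5 ≤ n) :
    ¬ (cycleGraph n).IsIndContained (ladderTree M d) := by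
  rintro ⟨φ⟩
  obtain ⟨k, rfl⟩ : ∃ k, n = k + 5 := ⟨n - 5, by omega⟩
  obtain ⟨i, hi⟩ := Finite.exists_max fun j => height (φ j)
  have hadj : ∀ u v, (ladderTree M d).Adj (φ u) (φ v) ↔ u - v = 1 ∨ v - u = 1 := fun u v => by
    rw [φ.map_adj_iff]
    exact cycleGraph_adj
  -- The five consecutive cycle vertices are centred at a highest one. The non-adjacencies hold
  -- because a difference of 3 is not `1` or `-1` modulo a number that is at least 5.
  refine not_middle_of_path (a := φ (i - 1 - 1)) (b := φ (i - 1)) (z := φ i) (c := φ (i + 1))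
    (e := φ (i + 1 + 1)) ((hadj _ _).mpr (Or.inl (by abel))) ((hadj _ _).mpr (Or.inl (by abel)))
    ((hadj _ _).mpr (Or.inr (by abel))) ((hadj _ _).mpr (Or.inr (by abel)))
    (φ.injective.ne ?_) (φ.injective.ne ?_) (φ.injective.ne ?_) (φ.injective.ne ?_)
    (fun h => ?_) (φ.injective.ne ?_) (fun h => ?_) (hi _) (hi _) (hi _) (hi _)
  · exact ne_of_sub_eq_nsmul_one 2 (by omega) (by omega) (by abel)
  · exact ne_of_sub_eq_nsmul_one 2 (by omega) (by omega) (by abel)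
  · exact (ne_of_sub_eq_nsmul_one 2 (by omega) (by omega) (by abel)).symm
  · exact ne_of_sub_eq_nsmul_one 3 (by omega) (by omega) (by abel)
  · rcases (hadj _ _).mp h with h | h
    · exact ne_of_sub_eq_nsmul_one 4 (by omega) (by omega) (by abel) h
    · exact ne_of_sub_eq_nsmul_one 2 (by omega) (by omega) (by abel) h.symm
  · exact (ne_of_sub_eq_nsmul_one 3 (by omega) (by omega) (by abel)).symm
  · rcases (hadj _ _).mp h with h | h
    · exact ne_of_sub_eq_nsmul_one 2 (by omega) (by omega) (by abel) h.symm
    · exact ne_of_sub_eq_nsmul_one 4 (by omega) (by omega) (by abel) h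

lemma not_cycleGraph_isIndContained_compl (n : ℕ) (hn : 5 ≤ n) :
    ¬ (cycleGraph n).IsIndContained (ladderTree M d)ᶜ := by
  intro hcon
  rcases eq_or_lt_of_le hn with rfl | hn6
  · have h5 : (cycleGraph 5).IsIndContained (cycleGraph 5)ᶜ :=
      ⟨⟨⟨fun i => 2 * i, by decide⟩, by decide⟩⟩
    exact not_cycleGraph_isIndContained 5 le_rfl
      (compl_isIndContained_compl.mp (h5.compl.trans (by rwa [compl_compl])))
  · obtain ⟨φ⟩ := hcon
    obtain ⟨k, rfl⟩ : ∃ k, n = k + 1 + 5 := ⟨n - 6, by omega⟩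
    obtain ⟨i, hi⟩ := Finite.exists_max fun j => height (φ j)
    have hadj : ∀ u v, u ≠ v → u - v ≠ 1 → v - u ≠ 1 → (ladderTree M d).Adj (φ u) (φ v) := by
      intro u v h1 h2 h3
      by_contra h
      have h4 : (ladderTree M d)ᶜ.Adj (φ u) (φ v) := ⟨φ.injective.ne h1, h⟩
      rw [φ.map_adj_iff] at h4
      exact (cycleGraph_adj.mp h4).elim h2 h3
    have hne : ∀ (j : ℕ) (x y : Fin (k + 1 + 5)), 0 < j → j < 6 → y - x = j • 1 → x ≠ y :=
      fun j x y h0 hj h => ne_of_sub_eq_nsmul_one j h0 (by omega) h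
    -- With at least six vertices, `i + 2`, `i + 3` and `i + 4` are not cyclic neighbors of `i`, so
    -- in the ladder tree a highest vertex gets three neighbors that are not higher.
    have hadj' : ∀ j : ℕ, 2 ≤ j → j ≤ 4 → (ladderTree M d).Adj (φ i) (φ (i + j • 1)) := by
      intro j h2 h4
      obtain ⟨l, rfl⟩ : ∃ l, j = l + 1 := ⟨j - 1, by omega⟩
      refine hadj _ _ (hne (l + 1) _ _ (by omega) (by omega) (by abel)) ?_ ?_
      · exact hne (l + 2) _ _ (by omega) (by omega) (by simp only [add_nsmul]; abel)
      · exact (hne l _ _ (by omega) (by omega) (by simp only [add_nsmul]; abel)).symm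
    exact not_three_lower_neighbors (hadj' 2 (by omega) (by omega))
      (hadj' 3 (by omega) (by omega)) (hadj' 4 (by omega) (by omega))
      (φ.injective.ne (hne 1 _ _ (by omega) (by omega) (by abel)))
      (φ.injective.ne (hne 2 _ _ (by omega) (by omega) (by abel)))
      (φ.injective.ne (hne 1 _ _ (by omega) (by omega) (by abel))) (hi _) (hi _) (hi _)

lemma ladderTree_isWeaklyChordal : (ladderTree M d).IsWeaklyChordal := fun n hn =>
  ⟨not_cycleGraph_isIndContained n hn, not_cycleGraph_isIndContained_compl n hn⟩

/-! ### Outerplanar drawings with vertices on a parabola -/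

/-- The point above `t` on the standard parabola. -/
noncomputable def parabola (t : ℝ) : EuclideanSpace ℝ (Fin 2) := !₂[t, t ^ 2]

@[simp] lemma parabola_zero (t : ℝ) : parabola t 0 = t := rfl

@[simp] lemma parabola_one (t : ℝ) : parabola t 1 = t ^ 2 := rfl

lemma parabola_injective : Function.Injective parabola := fun s t h => by
  simpa using congrArg (fun p => p 0) h

lemma eq_parabola {p : EuclideanSpace ℝ (Fin 2)} (h : p 1 = p 0 ^ 2) : p = parabola (p 0) := by
  ext i
  fin_cases i
  · rfl
  · exact h

/-- A point of a chord lies above the parabola, by the product of the horizontal distances to the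
ends of the chord. -/
lemma mem_chord {a b : ℝ} (hab : a ≤ b) {p : EuclideanSpace ℝ (Fin 2)}
    (hp : p ∈ segment ℝ (parabola a) (parabola b)) :
    a ≤ p 0 ∧ p 0 ≤ b ∧ p 1 - p 0 ^ 2 = (p 0 - a) * (b - p 0) := by
  obtain ⟨s, t, hs, ht, hst, rfl⟩ := hp
  obtain rfl : s = 1 - t := by linarith
  simp only [PiLp.add_apply, PiLp.smul_apply, parabola_zero, parabola_one, smul_eq_mul]
  refine ⟨by nlinarith, by nlinarith, by ring⟩

lemma mem_chord_or {a b : ℝ} {p : EuclideanSpace ℝ (Fin 2)}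
    (hp : p ∈ segment ℝ (parabola a) (parabola b)) :
    ((a ≤ p 0 ∧ p 0 ≤ b) ∨ (b ≤ p 0 ∧ p 0 ≤ a)) ∧ p 1 - p 0 ^ 2 = (p 0 - a) * (b - p 0) := by
  rcases le_total a b with h | h
  · obtain ⟨h1, h2, h3⟩ := mem_chord h hp
    exact ⟨Or.inl ⟨h1, h2⟩, h3⟩
  · rw [segment_symm] at hp
    obtain ⟨h1, h2, h3⟩ := mem_chord h hp
    exact ⟨Or.inr ⟨h1, h2⟩, by rw [h3]; ring⟩

lemma eq_or_eq_of_parabola_mem_chord {a b t : ℝ}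
    (h : parabola t ∈ segment ℝ (parabola a) (parabola b)) : t = a ∨ t = b := by
  have h' := (mem_chord_or h).2
  simp only [parabola_zero, parabola_one, sub_self, zero_eq_mul, sub_eq_zero] at h'
  exact h'.imp_right Eq.symm

/-- Two chords of the parabola that do not cross only meet in a common end. -/
lemma eq_parabola_of_mem_chords {a b x y : ℝ} (hab : a < b) (hxy : x < y)
    (hne : a ≠ x ∨ b ≠ y) (h1 : ¬ (a < x ∧ x < b ∧ b < y)) (h2 : ¬ (x < a ∧ a < y ∧ y < b))
    {p : EuclideanSpace ℝ (Fin 2)} (hp : p ∈ segment ℝ (parabola a) (parabola b))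
    (hp' : p ∈ segment ℝ (parabola x) (parabola y)) : p = parabola a ∨ p = parabola b := by
  obtain ⟨ha, hb, h3⟩ := mem_chord hab.le hp
  obtain ⟨hx, hy, h3'⟩ := mem_chord hxy.le hp'
  have key : p 0 = a ∨ p 0 = b := by
    by_contra hcon
    push Not at hcon
    have ha' : 0 < p 0 - a := sub_pos.mpr (lt_of_le_of_ne ha (Ne.symm hcon.1))
    have hb' : 0 < b - p 0 := sub_pos.mpr (lt_of_le_of_ne hb hcon.2)
    have hpos : 0 < (p 0 - a) * (b - p 0) := mul_pos ha' hb'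
    have heq : (p 0 - a) * (b - p 0) = (p 0 - x) * (y - p 0) := by rw [← h3, ← h3']
    have hx' : 0 < p 0 - x := by
      refine lt_of_le_of_ne (sub_nonneg.mpr hx) fun h => ?_
      rw [heq, ← h, zero_mul] at hpos
      exact hpos.false
    have hy' : 0 < y - p 0 := by
      refine lt_of_le_of_ne (sub_nonneg.mpr hy) fun h => ?_
      rw [heq, ← h, mul_zero] at hpos
      exact hpos.false
    -- Chords that do not cross are nested here, and at an interior point the longer one has the
    -- larger product of distances, against `heq`.
    rcases lt_trichotomy a x with h | h | h
    · have hyb : y ≤ b := by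
        by_contra h'
        exact h1 ⟨h, by linarith, not_le.mp h'⟩
      nlinarith
    · subst h
      have : b - p 0 = y - p 0 := mul_left_cancel₀ ha'.ne' heq
      exact hne.elim (fun h => h rfl) fun h => h (by linarith)
    · have hby : b ≤ y := by
        by_contra h'
        exact h2 ⟨h, by linarith, not_le.mp h'⟩
      nlinarith
  have hpar : p = parabola (p 0) := by
    refine eq_parabola ?_
    rcases key with h | h <;> rw [h] at h3 <;> rw [h] <;> linarith [h3, sub_self a, sub_self b]
  rcases key with h | h
  · exact Or.inl (h ▸ hpar)
  · exact Or.inr (h ▸ hpar)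

variable {V : Type*} {G : SimpleGraph V}

/-- The straight-line drawing with the vertices on the parabola. -/
noncomputable def chordDrawing (G : SimpleGraph V) (f : V → ℝ) (hf : Function.Injective f)
    (hcross : ∀ a b u v, G.Adj a b → G.Adj u v → ¬ (f a < f u ∧ f u < f b ∧ f b < f v)) :
    G.PlaneDrawing where
  point v := parabola (f v)
  arc := Sym2.lift ⟨fun u v => segment ℝ (parabola (f u)) (parabola (f v)),
    fun _ _ => segment_symm ℝ _ _⟩
  point_injective := parabola_injective.comp hf
  arc_eq u v h := by
    refine ⟨_root_.Path.segment _ _, fun s t hst => ?_, ?_⟩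
    · have hne : parabola (f u) ≠ parabola (f v) :=
        (parabola_injective.comp hf).ne h.ne
      exact Subtype.ext (AffineMap.lineMap_injective ℝ hne hst)
    · simp
  mem_of_point_mem_arc := by
    intro e he w hw
    induction e using Sym2.inductionOn with
    | hf u v =>
      rcases eq_or_eq_of_parabola_mem_chord hw with h | h
      · rw [hf h]; exact Sym2.mem_mk_left _ _
      · rw [hf h]; exact Sym2.mem_mk_right _ _
  arc_inter_arc := by
    have key : ∀ a b u v, G.Adj a b → G.Adj u v → s(a, b) ≠ s(u, v) → f a < f b → f u < f v →
        segment ℝ (parabola (f a)) (parabola (f b)) ∩ segment ℝ (parabola (f u)) (parabola (f v))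
          ⊆ Set.range fun v => parabola (f v) := by
      rintro a b u v hab huv hne h1 h2 p ⟨hp, hp'⟩
      have hne' : f a ≠ f u ∨ f b ≠ f v := by
        by_contra hcon
        push Not at hcon
        exact hne (by rw [hf hcon.1, hf hcon.2])
      rcases eq_parabola_of_mem_chords h1 h2 hne' (hcross a b u v hab huv)
        (hcross u v a b huv hab) hp hp' with h | h
      · exact ⟨a, h.symm⟩
      · exact ⟨b, h.symm⟩
    intro e he e' he' hne
    induction e using Sym2.inductionOn with
    | hf a b =>
    induction e' using Sym2.inductionOn with
    | hf u v =>
      have hab : G.Adj a b := he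
      have huv : G.Adj u v := he'
      simp only [Sym2.lift_mk]
      rcases lt_or_gt_of_ne (hf.ne hab.ne) with h1 | h1 <;>
        rcases lt_or_gt_of_ne (hf.ne huv.ne) with h2 | h2
      · exact key a b u v hab huv hne h1 h2
      · rw [segment_symm ℝ (parabola (f u))]
        exact key a b v u hab huv.symm (by rwa [Sym2.eq_swap (a := v)]) h1 h2
      · rw [segment_symm ℝ (parabola (f a))]
        exact key b a u v hab.symm huv (by rwa [Sym2.eq_swap (a := b)]) h1 h2
      · rw [segment_symm ℝ (parabola (f a)), segment_symm ℝ (parabola (f u))]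
        exact key b a v u hab.symm huv.symm
          (by rwa [Sym2.eq_swap (a := b), Sym2.eq_swap (a := v)]) h1 h2

/-- The open vertical ray below a point of the parabola. -/
def rayBelow (t : ℝ) : Set (EuclideanSpace ℝ (Fin 2)) := {p | p 0 = t ∧ p 1 < t ^ 2}

lemma convex_rayBelow (t : ℝ) : Convex ℝ (rayBelow t) := by
  rintro p ⟨hp, hp'⟩ q ⟨hq, hq'⟩ a b ha hb hab
  obtain rfl : a = 1 - b := by linarith
  simp only [rayBelow, Set.mem_ofPred_eq, PiLp.add_apply, PiLp.smul_apply, smul_eq_mul, hp, hq]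
  refine ⟨by ring, ?_⟩
  rcases hb.eq_or_lt with rfl | hb
  · simpa using hp'
  · nlinarith

lemma not_isBounded_rayBelow (t : ℝ) : ¬ Bornology.IsBounded (rayBelow t) := by
  intro h
  obtain ⟨C, hC⟩ := h.exists_norm_le
  have h1 := hC !₂[t, -(|C| + 1)] ⟨rfl, by
    change -(|C| + 1) < t ^ 2
    nlinarith [abs_nonneg C, sq_nonneg t]⟩
  have h2 := (PiLp.norm_apply_le (!₂[t, -(|C| + 1)] : EuclideanSpace ℝ (Fin 2)) 1).trans h1
  have h3 : ‖(!₂[t, -(|C| + 1)] : EuclideanSpace ℝ (Fin 2)) 1‖ = |C| + 1 := by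
    change ‖-(|C| + 1)‖ = _
    rw [norm_neg, Real.norm_of_nonneg (by positivity)]
  linarith [le_abs_self C]

/-- All chords lie on or above the parabola, so the vertical ray below each vertex avoids the
drawing. It is connected and unbounded, hence lies in the unbounded face, and it has the vertex as a
limit point. -/
lemma isOuterplanar_of_noncrossing (G : SimpleGraph V) (f : V → ℝ) (hf : Function.Injective f)
    (hcross : ∀ a b u v, G.Adj a b → G.Adj u v → ¬ (f a < f u ∧ f u < f b ∧ f b < f v)) :
    G.IsOuterplanar := by
  refine ⟨chordDrawing G f hf hcross, fun v => ?_⟩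
  set D := chordDrawing G f hf hcross with hD
  have habove : ∀ p ∈ D.support, p 0 ^ 2 ≤ p 1 := by
    rintro p (⟨w, rfl⟩ | hp)
    · exact le_rfl
    · simp only [Set.mem_iUnion] at hp
      obtain ⟨e, he, hp⟩ := hp
      induction e using Sym2.inductionOn with
      | hf a b =>
        obtain ⟨h1, h2⟩ := mem_chord_or hp
        rcases h1 with h1 | h1
        · nlinarith
        · nlinarith
  have hray : ∀ t, rayBelow t ⊆ D.supportᶜ := by
    rintro t p ⟨h1, h2⟩ hp
    have := habove p hp
    rw [h1] at this
    linarith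
  have hface : ∀ t, rayBelow t ⊆ D.unboundedFace := by
    intro t p hp
    refine ⟨hray t hp, fun hb => not_isBounded_rayBelow t (hb.subset ?_)⟩
    exact (convex_rayBelow t).isPreconnected.subset_connectedComponentIn hp (hray t)
  refine ⟨?_, fun h => (interior_subset h).1 (Or.inl ⟨v, rfl⟩)⟩
  have hcont : Continuous fun ε : ℝ => (!₂[f v, f v ^ 2 - ε] : EuclideanSpace ℝ (Fin 2)) := by
    refine (PiLp.continuous_toLp 2 _).comp (continuous_pi fun i => ?_)
    fin_cases i
    · exact continuous_const
    · exact continuous_const.sub continuous_id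
  have hlim := (hcont.tendsto 0).mono_left (nhdsWithin_le_nhds (s := Set.Ioi 0))
  have h0 : (!₂[f v, f v ^ 2 - 0] : EuclideanSpace ℝ (Fin 2)) = D.point v := by
    rw [sub_zero]; rfl
  rw [h0] at hlim
  refine mem_closure_of_tendsto hlim ?_
  filter_upwards [self_mem_nhdsWithin] with ε hε
  refine hface (f v) ⟨rfl, ?_⟩
  change f v ^ 2 - ε < f v ^ 2
  linarith [Set.mem_Ioi.mp hε]

/-! ### A layout of the ladder tree on a line -/

lemma exists_cons_isSuffix {w v : List Bool} (h : w <:+ v) (hne : w ≠ v) :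
    ∃ c, c :: w <:+ v := by
  induction v with
  | nil => exact absurd (List.suffix_nil.mp h) hne
  | cons a v ih =>
    have h' := (List.suffix_cons_iff.mp h).resolve_left hne
    by_cases hwv : w = v
    · exact ⟨a, hwv ▸ List.suffix_rfl⟩
    · obtain ⟨c, hc⟩ := ih h' hwv
      exact ⟨c, hc.trans (List.suffix_cons _ _)⟩

/-- The relative positions of two nodes: equal, one above the other, or in different branches above
a node `u`. -/
lemma suffix_trichotomy (w v : List Bool) : w = v ∨ (∃ c, c :: w <:+ v) ∨ (∃ c, c :: v <:+ w) ∨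
    ∃ u c c', c ≠ c' ∧ c :: u <:+ w ∧ c' :: u <:+ v := by
  induction w with
  | nil =>
    by_cases h : [] = v
    · exact Or.inl h
    · exact Or.inr (Or.inl (exists_cons_isSuffix List.nil_suffix h))
  | cons a w ih =>
    rcases ih with rfl | ⟨c, hc⟩ | ⟨c, hc⟩ | ⟨u, c, c', hne, h, h'⟩
    · exact Or.inr (Or.inr (Or.inl ⟨a, List.suffix_rfl⟩))
    · by_cases hca : c = a
      · subst hca
        by_cases h : c :: w = v
        · exact Or.inl h
        · exact Or.inr (Or.inl (exists_cons_isSuffix hc h))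
      · exact Or.inr (Or.inr (Or.inr ⟨w, a, c, Ne.symm hca, List.suffix_rfl, hc⟩))
    · exact Or.inr (Or.inr (Or.inl ⟨c, hc.trans (List.suffix_cons _ _)⟩))
    · exact Or.inr (Or.inr (Or.inr ⟨u, c, c', hne, h.trans (List.suffix_cons _ _), h'⟩))

/-- The number of a rail vertex in the cyclic order of the ladder between two rails. -/
def digit (M : ℕ) (c : Bool) (k : ℕ) : ℕ := if c then 2 * M + 2 - k else k + 1

lemma digit_true (k : ℕ) : digit M true k = 2 * M + 2 - k := rfl

lemma digit_false (k : ℕ) : digit M false k = k + 1 := rfl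

lemma digit_bounds (c : Bool) {k : ℕ} (hk : k ≤ M) : 1 ≤ digit M c k ∧ digit M c k ≤ 2 * M + 2 := by
  cases c
  · rw [digit_false]; omega
  · rw [digit_true]; omega

lemma digit_top_lt (c : Bool) : digit M c M + 1 ≤ 2 * M + 3 := by
  have := (digit_bounds (M := M) c le_rfl).2
  omega

/-- The distance between consecutive vertices of the ladder above a node of depth `n`. -/
noncomputable def scale (M n : ℕ) : ℝ := ((2 * M + 3 : ℝ) ^ (n + 1))⁻¹

lemma scale_pos (M n : ℕ) : 0 < scale M n := by
  unfold scale
  positivity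

lemma scale_succ (M n : ℕ) : (2 * M + 3 : ℝ) * scale M (n + 1) = scale M n := by
  unfold scale
  have : (2 * M + 3 : ℝ) ≠ 0 := by positivity
  rw [pow_succ _ (n + 1)]
  field_simp

/-- The position of a node on the line. -/
noncomputable def base (M : ℕ) : List Bool → ℝ
  | [] => 0
  | c :: w => base M w + digit M c M * scale M w.length

/-- The positions of the vertices above the node `w`, and of the node itself. -/
def span (M : ℕ) (w : List Bool) : Set ℝ :=
  Set.Ico (base M w) (base M w + (2 * M + 3) * scale M w.length)

lemma span_cons (c : Bool) (w : List Bool) : span M (c :: w) =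
    Set.Ico (base M w + digit M c M * scale M w.length)
      (base M w + (digit M c M + 1 : ℕ) * scale M w.length) := by
  rw [span, List.length_cons, scale_succ, base]
  congr 1
  push_cast
  ring

/-- The factor `2 * M + 3` between scales makes the span of a child exactly one cell of its parent's
grid. -/
lemma span_anti {w v : List Bool} (h : w <:+ v) : span M v ⊆ span M w := by
  induction v with
  | nil => rw [List.suffix_nil.mp h]
  | cons a v ih =>
    rcases List.suffix_cons_iff.mp h with rfl | h'
    · exact subset_rfl
    · refine subset_trans ?_ (ih h')
      rw [span_cons, span]
      have h1 := (scale_pos M v.length).le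
      have h2 : ((digit M a M + 1 : ℕ) : ℝ) ≤ ((2 * M + 3 : ℕ) : ℝ) := Nat.cast_le.mpr (digit_top_lt a)
      push_cast at h2 ⊢
      exact Set.Ico_subset_Ico (by nlinarith [(digit M a M).cast_nonneg (α := ℝ)]) (by nlinarith)

lemma mem_span {w : List Bool} {i : ℕ} (hi : i ≤ 2 * M + 2) :
    base M w + i * scale M w.length ∈ span M w := by
  have h1 := scale_pos M w.length
  have h2 : (i : ℝ) ≤ ((2 * M + 2 : ℕ) : ℝ) := Nat.cast_le.mpr hi
  push_cast at h2
  exact ⟨by nlinarith [i.cast_nonneg (α := ℝ)], by nlinarith⟩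

lemma mem_span_nonneg {w : List Bool} {x : ℝ} (hx : x ∈ span M w) : 0 ≤ x :=
  (span_anti List.nil_suffix hx).1

lemma grid_lt_iff {w : List Bool} {i j : ℕ} :
    base M w + i * scale M w.length < base M w + j * scale M w.length ↔ i < j := by
  rw [add_lt_add_iff_left, mul_lt_mul_iff_left₀ (scale_pos M _), Nat.cast_lt]

/-- No vertex of the ladder above `w` lies strictly between two positions above a child of `w`. -/
lemma not_between {c : Bool} {w : List Bool} {x y : ℝ} (hx : x ∈ span M (c :: w))
    (hy : y ∈ span M (c :: w)) (i : ℕ) (h1 : x < base M w + i * scale M w.length)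
    (h2 : base M w + i * scale M w.length ≤ y) : False := by
  rw [span_cons] at hx hy
  have h3 := grid_lt_iff.mp (lt_of_le_of_lt hx.1 h1)
  have h4 := grid_lt_iff.mp (lt_of_le_of_lt h2 hy.2)
  omega

lemma span_separated {c c' : Bool} (hne : c ≠ c') (w : List Bool) :
    (∀ x ∈ span M (c :: w), ∀ y ∈ span M (c' :: w), x < y) ∨
      ∀ x ∈ span M (c :: w), ∀ y ∈ span M (c' :: w), y < x := by
  have key : ∀ {a a' : Bool}, digit M a M + 1 ≤ digit M a' M →
      ∀ x ∈ span M (a :: w), ∀ y ∈ span M (a' :: w), x < y := by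
    intro a a' h x hx y hy
    rw [span_cons] at hx hy
    refine hx.2.trans_le (le_trans ?_ hy.1)
    exact add_le_add_right (mul_le_mul_of_nonneg_right (Nat.cast_le.mpr h) (scale_pos M _).le) _
  have h : digit M false M + 1 ≤ digit M true M := by
    rw [digit_true, digit_false]; omega
  cases c <;> cases c'
  · exact absurd rfl hne
  · exact Or.inl (key h)
  · exact Or.inr fun x hx y hy => key h y hy x hx
  · exact absurd rfl hne

/-- The intervals that are spanned by the edges in the layout: unit intervals to the left of the
root, and intervals between vertices of the ladder above some node `w`. -/
def IsChord (M : ℕ) (p q : ℝ) : Prop :=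
  (∃ n : ℕ, p = -((n + 1 : ℕ) : ℝ) ∧ q = -(n : ℝ)) ∨
  ∃ (w : List Bool) (i j : ℕ), i < j ∧ j ≤ 2 * M + 2 ∧
    (j = i + 1 ∨ (i = 0 ∧ j = 2 * M + 2) ∨ i + j = 2 * M + 3) ∧
    p = base M w + i * scale M w.length ∧ q = base M w + j * scale M w.length

lemma IsChord.lt {p q : ℝ} (h : IsChord M p q) : p < q := by
  rcases h with ⟨n, rfl, rfl⟩ | ⟨w, i, j, hij, -, -, rfl, rfl⟩
  · push_cast; linarith
  · exact grid_lt_iff.mpr hij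

lemma IsChord.not_cross {p q x y : ℝ} (h : IsChord M p q) (h' : IsChord M x y) :
    ¬ (p < x ∧ x < q ∧ q < y) := by
  rintro ⟨h1, h2, h3⟩
  rcases h with ⟨n, rfl, rfl⟩ | ⟨w, i, j, hij, hj, htype, rfl, rfl⟩ <;>
    rcases h' with ⟨n', rfl, rfl⟩ | ⟨w', i', j', hij', hj', htype', rfl, rfl⟩
  · rw [neg_lt_neg_iff, Nat.cast_lt] at h1 h2
    omega
  · have := mem_span_nonneg (mem_span (M := M) (w := w') (i := i') (by omega))
    linarith [n.cast_nonneg (α := ℝ)]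
  · have := mem_span_nonneg (mem_span (M := M) (w := w) (i := i) (by omega))
    linarith [(n' + 1).cast_nonneg (α := ℝ)]
  · have hi := mem_span (M := M) (w := w) (i := i) (by omega)
    have hj := mem_span (M := M) (w := w) (i := j) hj
    have hi' := mem_span (M := M) (w := w') (i := i') (by omega)
    have hj' := mem_span (M := M) (w := w') (i := j') hj'
    rcases suffix_trichotomy w w' with rfl | ⟨c, hc⟩ | ⟨c, hc⟩ | ⟨u, c, c', hne, hc, hc'⟩
    · rw [grid_lt_iff] at h1 h2 h3
      omega
    · exact not_between (span_anti hc hi') (span_anti hc hj') _ h2 h3.le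
    · exact not_between (span_anti hc hi) (span_anti hc hj) _ h1 h2.le
    · rcases span_separated (M := M) hne u with h | h
      · exact (h _ (span_anti hc hj) _ (span_anti hc' hi')).not_gt h2
      · exact (h _ (span_anti hc hi) _ (span_anti hc' hi')).not_gt h1

/-- The position of a vertex on the line. -/
noncomputable def position (M : ℕ) : List Bool × ℕ → ℝ
  | ([], k) => (k : ℝ) - M
  | (c :: w, k) => base M w + digit M c k * scale M w.length

lemma position_node (w : List Bool) : position M (w, M) = base M w := by
  cases w with
  | nil => simp [position, base]
  | cons c w => rfl

lemma position_injective : Function.Injective fun z : Vertex M d => position M z.1 := by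
  have hnil : ∀ (k : ℕ) (c : Bool) (w : List Bool) (l : ℕ), k ≤ M → l ≤ M →
      position M ([], k) ≠ position M (c :: w, l) := by
    intro k c w l hk hl h
    simp only [position] at h
    have h1 := mem_span_nonneg (M := M) (w := w) (by simpa using mem_span (i := 0) (by omega))
    have h2 := mul_pos (Nat.cast_pos (α := ℝ).mpr (digit_bounds c hl).1) (scale_pos M w.length)
    have h3 : (k : ℝ) ≤ M := Nat.cast_le.mpr hk
    linarith
  have hext : ∀ (c : Bool) (w : List Bool) (k : ℕ) (c' : Bool) (w' : List Bool) (l : ℕ) (b : Bool),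
      k ≤ M → l ≤ M → b :: w <:+ w' → position M (c :: w, k) ≠ position M (c' :: w', l) := by
    intro c w k c' w' l b hk hl hb h
    simp only [position] at h
    have h1 := span_anti hb (mem_span (M := M) (digit_bounds c' hl).2)
    have h2 := span_anti hb (mem_span (M := M) (w := w') (i := 0) (by omega))
    -- A vertex of the higher ladder lies strictly to the right of `base M w'`, inside a cell of the
    -- lower grid, so it is not a grid point.
    refine not_between h2 h1 (digit M c k) ?_ h.le
    rw [h]
    exact grid_lt_iff.mpr (digit_bounds c' hl).1
  rintro ⟨⟨v, k⟩, hv, hk⟩ ⟨⟨v', l⟩, hv', hl⟩ h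
  simp only at hk hl h
  rw [Subtype.mk.injEq]
  rcases v with _ | ⟨c, w⟩ <;> rcases v' with _ | ⟨c', w'⟩
  · simpa [position] using h
  · exact absurd h (hnil _ _ _ _ hk hl)
  · exact absurd h.symm (hnil _ _ _ _ hl hk)
  · rcases suffix_trichotomy w w' with rfl | ⟨b, hb⟩ | ⟨b, hb⟩ | ⟨u, b, b', hne, hb, hb'⟩
    · have hd : digit M c k = digit M c' l := by
        refine le_antisymm ?_ ?_ <;> refine not_lt.mp fun hlt => ?_
        · exact (grid_lt_iff (M := M) (w := w).mpr hlt).ne h.symm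
        · exact (grid_lt_iff (M := M) (w := w).mpr hlt).ne h
      cases c <;> cases c' <;> simp only [digit_true, digit_false] at hd
      · rw [show k = l by omega]
      · omega
      · omega
      · rw [show k = l by omega]
    · exact absurd h (hext _ _ _ _ _ _ b hk hl hb)
    · exact absurd h.symm (hext _ _ _ _ _ _ b hl hk hb)
    · have h1 := span_anti hb (mem_span (M := M) (digit_bounds c hk).2)
      have h2 := span_anti hb' (mem_span (M := M) (digit_bounds c' hl).2)
      simp only [position] at h
      rcases span_separated (M := M) hne u with h' | h'
      · exact absurd h (h' _ h1 _ h2).ne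
      · exact absurd h.symm (h' _ h1 _ h2).ne

lemma isChord_of_isStep {a b : Vertex M d} (h : IsStep M a.1 b.1) :
    IsChord M (position M a.1) (position M b.1) ∨ IsChord M (position M b.1) (position M a.1) := by
  obtain ⟨⟨v, k⟩, hv, hk⟩ := a
  obtain ⟨⟨v', l⟩, hv', hl⟩ := b
  simp only at hk hl
  have h' : (v' = v ∧ l = k + 1) ∨ ∃ c, v' = c :: v ∧ k = M ∧ l = 0 := h
  clear h
  rcases h' with ⟨rfl, rfl⟩ | ⟨c, rfl, hkM, rfl⟩
  · rcases v' with _ | ⟨c, w⟩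
    · refine Or.inl (Or.inl ⟨M - (k + 1), ?_, ?_⟩)
      · simp only [position]
        rw [show M - (k + 1) + 1 = M - k by omega, Nat.cast_sub hk]
        ring
      · simp only [position]
        rw [Nat.cast_sub hl]
        ring
    · cases c
      · exact Or.inl (Or.inr ⟨w, digit M false k, digit M false (k + 1),
          by simp only [digit_false]; omega, by simp only [digit_false]; omega,
          Or.inl rfl, rfl, rfl⟩)
      · exact Or.inr (Or.inr ⟨w, digit M true (k + 1), digit M true k,
          by simp only [digit_true]; omega, by simp only [digit_true]; omega,
          by simp only [digit_true]; omega, rfl, rfl⟩)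
  · refine Or.inl (Or.inr ⟨v, 0, digit M c 0, ?_, ?_, ?_, ?_, rfl⟩)
    · exact (digit_bounds c (Nat.zero_le M)).1
    · exact (digit_bounds c (Nat.zero_le M)).2
    · cases c
      · exact Or.inl rfl
      · exact Or.inr (Or.inl ⟨rfl, rfl⟩)
    · simp [hkM, position_node]

lemma isChord_of_isRung {a b : Vertex M d} (h : IsRung a.1 b.1) :
    IsChord M (position M a.1) (position M b.1) ∨ IsChord M (position M b.1) (position M a.1) := by
  obtain ⟨⟨v, k⟩, hv, hk⟩ := a
  obtain ⟨⟨v', l⟩, hv', hl⟩ := b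
  obtain ⟨c, w, rfl, rfl, rfl⟩ := h
  simp only at hk
  have key : IsChord M (position M (false :: w, k)) (position M (true :: w, k)) :=
    Or.inr ⟨w, digit M false k, digit M true k, by simp only [digit_true, digit_false]; omega,
      by simp only [digit_true]; omega, by simp only [digit_true, digit_false]; omega, rfl, rfl⟩
  cases c
  · exact Or.inl key
  · exact Or.inr key

lemma isChord_of_adj {a b : Vertex M d} (h : (ladderTree M d).Adj a b)
    (hlt : position M a.1 < position M b.1) : IsChord M (position M a.1) (position M b.1) := by
  have h' : IsChord M (position M a.1) (position M b.1) ∨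
      IsChord M (position M b.1) (position M a.1) := by
    rcases h with h | h | h
    · exact isChord_of_isStep h
    · exact (isChord_of_isStep h).symm
    · exact isChord_of_isRung h
  exact h'.resolve_right fun h => h.lt.not_gt hlt

lemma ladderTree_isOuterplanar : (ladderTree M d).IsOuterplanar := by
  refine isOuterplanar_of_noncrossing _ (fun z => position M z.1) position_injective ?_
  rintro a b u v hab huv ⟨h1, h2, h3⟩
  exact (isChord_of_adj hab (h1.trans h2)).not_cross (isChord_of_adj huv (h2.trans h3))
    ⟨h1, h2, h3⟩

end LadderTree

theorem mainTheorem6 (c : ℝ) (hc : 2 < c) :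
    (¬ ∃ μ : ℕ, ∀ (V : Type) [Finite V] (G : SimpleGraph V),
        G.Connected → G.IsWeaklyChordal → G.AdmitsCollectiveTreeSpanners μ c) ∧
    (¬ ∃ μ : ℕ, ∀ (V : Type) [Finite V] (G : SimpleGraph V),
        G.Connected → G.IsOuterplanar → G.AdmitsCollectiveTreeSpanners μ c) := by
  constructor
  · rintro ⟨μ, h⟩
    -- The two `le_rfl` fix the parameters: `M = ⌈c⌉₊`, and the depth equal to the bound for `μ`
    -- trees.
    exact LadderTree.not_admits_ladderTree μ ⌈c⌉₊ c (Nat.le_ceil c) le_rfl le_rfl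
      (h _ _ LadderTree.ladderTree_connected LadderTree.ladderTree_isWeaklyChordal)
  · rintro ⟨μ, h⟩
    exact LadderTree.not_admits_ladderTree μ ⌈c⌉₊ c (Nat.le_ceil c) le_rfl le_rfl
      (h _ _ LadderTree.ladderTree_connected LadderTree.ladderTree_isOuterplanar)
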